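/- For $\varepsilon>0$, let $A_\varepsilon$ (the soft torus) be the universal unital $C^*$-algebra generated by two unitaries $u,v$ subject to the relation $\|uv-vu\|\le\varepsilon$; that is, whenever $U,V$ are unitaries in a unital $C^*$-algebra $D$ with $\|UV-VU\|\le\varepsilon$, there is exactly one unital $*$-homomorphism $A_\varepsilon\to D$ with $u\mapsto U$ and $v\mapsto V$. **Theorem.** For every $\varepsilon>0$, the $C^*$-algebra $A_\varepsilon$ is residually finite dimensional: there is a family $(\pi_i)_{i\in I}$ of unital $*$-homomorphisms $\pi_i:A_\varepsilon\to B(H_i)$, with each $H_i$ a finite-dimensional complex Hilbert space, such that for every nonzero $a\in A_\varepsilon$ there is an $i\in I$ with $\pi_i(a)\neq 0$. -/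

import Mathlib

noncomputable section

/-! ### The group `*`-algebra of the free group on two generators

This is the universal unital complex `*`-algebra generated by two unitaries. -/

/-- The complex group algebra of the free group on two generators. -/
abbrev FreeUnitaryAlg : Type := MonoidAlgebra ℂ (FreeGroup (Fin 2))

namespace FreeUnitaryAlg

open MonoidAlgebra (single)

/-- The involution `∑ c_g g ↦ ∑ conj(c_g) g⁻¹`, as an additive map. -/
def starAux : FreeUnitaryAlg →+ FreeUnitaryAlg where
  toFun x := x.coeff.sum fun g c => single g⁻¹ (star c)
  map_zero' := by simp
  map_add' x y := by
    rw [MonoidAlgebra.coeff_add, Finsupp.sum_add_index']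
    · intro g; simp
    · intro g c d; simp [MonoidAlgebra.single_add]

theorem starAux_single (g : FreeGroup (Fin 2)) (c : ℂ) :
    starAux (single g c) = single g⁻¹ (star c) := by
  simp [starAux]

instance : StarRing FreeUnitaryAlg where
  star := starAux
  star_involutive x := by
    induction x using MonoidAlgebra.induction_linear with
    | zero => simp
    | add x y hx hy => rw [map_add, map_add, hx, hy]
    | single g c => simp [starAux_single]
  star_mul x y := by
    change starAux (x * y) = starAux y * starAux x
    induction x using MonoidAlgebra.induction_linear with
    | zero => simp
    | add x x' hx hx' => rw [add_mul, map_add, hx, hx', map_add, mul_add]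
    | single g c =>
      induction y using MonoidAlgebra.induction_linear with
      | zero => simp
      | add x x' hx hx' => rw [mul_add, map_add, hx, hx', map_add, add_mul]
      | single h d => simp [starAux_single, MonoidAlgebra.single_mul_single, mul_comm]
  star_add x y := map_add starAux x y

theorem star_single (g : FreeGroup (Fin 2)) (c : ℂ) :
    star (single g c : FreeUnitaryAlg) = single g⁻¹ (star c) := starAux_single g c

instance : StarModule ℂ FreeUnitaryAlg where
  star_smul a x := by
    induction x using MonoidAlgebra.induction_linear with
    | zero => simp
    | add x y hx hy => rw [smul_add, star_add, hx, hy, star_add, smul_add]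
    | single g c => simp [star_single, MonoidAlgebra.smul_single]

/-- The first canonical unitary generator. -/
def u : FreeUnitaryAlg := single (FreeGroup.of 0) 1

/-- The second canonical unitary generator. -/
def v : FreeUnitaryAlg := single (FreeGroup.of 1) 1

theorem star_mul_self_single (g : FreeGroup (Fin 2)) :
    star (single g 1 : FreeUnitaryAlg) * single g 1 = 1 := by
  simp [star_single, MonoidAlgebra.single_mul_single, MonoidAlgebra.one_def]

theorem self_mul_star_single (g : FreeGroup (Fin 2)) :
    (single g 1 : FreeUnitaryAlg) * star (single g 1 : FreeUnitaryAlg) = 1 := by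
  simp [star_single, MonoidAlgebra.single_mul_single, MonoidAlgebra.one_def]

/-- The unital `*`-homomorphism sending the canonical generators to two given unitaries. -/
def lift {D : Type*} [Ring D] [StarRing D] [Algebra ℂ D] [StarModule ℂ D]
    (U V : unitary D) : FreeUnitaryAlg →⋆ₐ[ℂ] D where
  __ := MonoidAlgebra.lift ℂ D (FreeGroup (Fin 2))
    ((unitary D).subtype.comp (FreeGroup.lift ![U, V]))
  map_star' x := by
    change MonoidAlgebra.lift ℂ D (FreeGroup (Fin 2)) _ (star x)
      = star (MonoidAlgebra.lift ℂ D (FreeGroup (Fin 2)) _ x)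
    induction x using MonoidAlgebra.induction_linear with
    | zero => simp
    | add x y hx hy => rw [star_add, map_add, map_add, star_add, hx, hy]
    | single g c => simp [star_single, star_smul, ← Unitary.star_eq_inv]

theorem lift_single {D : Type*} [Ring D] [StarRing D] [Algebra ℂ D] [StarModule ℂ D]
    (U V : unitary D) (g : FreeGroup (Fin 2)) (c : ℂ) :
    lift U V (single g c) = c • (FreeGroup.lift ![U, V] g : D) :=
  MonoidAlgebra.lift_single ..

theorem lift_u {D : Type*} [Ring D] [StarRing D] [Algebra ℂ D] [StarModule ℂ D]
    (U V : unitary D) : lift U V u = U := by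
  simp [u, lift_single]

theorem lift_v {D : Type*} [Ring D] [StarRing D] [Algebra ℂ D] [StarModule ℂ D]
    (U V : unitary D) : lift U V v = V := by
  simp [v, lift_single]

/-- Two unital `*`-homomorphisms that agree on the generators are equal. -/
theorem hom_ext {D : Type*} [Ring D] [StarRing D] [Algebra ℂ D]
    {φ ψ : FreeUnitaryAlg →⋆ₐ[ℂ] D} (hu : φ u = ψ u) (hv : φ v = ψ v) : φ = ψ := by
  have key : (φ : FreeUnitaryAlg →ₐ[ℂ] D) = ψ := by
    refine (MonoidAlgebra.lift ℂ D (FreeGroup (Fin 2))).symm.injective ?_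
    apply FreeGroup.ext_hom
    intro i
    fin_cases i
    · simpa [u] using hu
    · simpa [v] using hv
  ext x
  exact congrArg (fun f : FreeUnitaryAlg →ₐ[ℂ] D => f x) key

end FreeUnitaryAlg

/-! ### The soft torus -/

/-- `p` is a `C*`-seminorm on the free `*`-algebra on two unitaries `u, v` for which
`p (u v - v u) ≤ ε`. -/
structure IsSoftSeminorm (ε : ℝ) (p : Seminorm ℂ FreeUnitaryAlg) : Prop where
  mul_le : ∀ x y, p (x * y) ≤ p x * p y
  star_mul_self : ∀ x, p (star x * x) = p x * p x
  comm_le : p (FreeUnitaryAlg.u * FreeUnitaryAlg.v - FreeUnitaryAlg.v * FreeUnitaryAlg.u) ≤ ε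

/-- The largest `C*`-seminorm on the free `*`-algebra on two unitaries `u, v` for which the
norm of `u v - v u` is at most `ε`. -/
def softSeminorm (ε : ℝ) : Seminorm ℂ FreeUnitaryAlg := sSup {p | IsSoftSeminorm ε p}

namespace IsSoftSeminorm

variable {ε : ℝ} {p : Seminorm ℂ FreeUnitaryAlg}

theorem single_le (hp : IsSoftSeminorm ε p) (g : FreeGroup (Fin 2)) :
    p (MonoidAlgebra.single g 1) ≤ 1 := by
  have h1 : p 1 = p 1 * p 1 := by simpa using hp.star_mul_self 1
  have h2 := hp.star_mul_self (MonoidAlgebra.single g 1)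
  rw [FreeUnitaryAlg.star_mul_self_single] at h2
  have h3 := apply_nonneg p (MonoidAlgebra.single g 1)
  have h4 : p 1 ≤ 1 := by
    by_contra! h
    nlinarith
  by_contra! h
  nlinarith

theorem map_star (hp : IsSoftSeminorm ε p) (x : FreeUnitaryAlg) : p (star x) = p x := by
  have key : ∀ y : FreeUnitaryAlg, p y ≤ p (star y) := by
    intro y
    have h1 := hp.star_mul_self y
    have h2 := hp.mul_le (star y) y
    have h3 := apply_nonneg p y
    have h4 := apply_nonneg p (star y)
    by_contra! h
    nlinarith
  exact le_antisymm (by simpa using key (star x)) (key x)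

theorem norm_lift {D : Type*} [CStarAlgebra D] (U V : unitary D)
    (h : ‖(U * V - V * U : D)‖ ≤ ε) :
    IsSoftSeminorm ε ((normSeminorm ℂ D).comp
      (FreeUnitaryAlg.lift U V : FreeUnitaryAlg →ₐ[ℂ] D).toLinearMap) where
  mul_le x y := by simpa using norm_mul_le _ _
  star_mul_self x := by
    have := CStarRing.norm_star_mul_self (x := FreeUnitaryAlg.lift U V x)
    rw [← StarHomClass.map_star] at this
    simpa using this
  comm_le := by simpa [FreeUnitaryAlg.lift_u, FreeUnitaryAlg.lift_v] using h

end IsSoftSeminorm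

theorem bddAbove_isSoftSeminorm (ε : ℝ) : BddAbove {p | IsSoftSeminorm ε p} := by
  rw [Seminorm.bddAbove_iff, bddAbove_pi]
  intro x
  induction x using MonoidAlgebra.induction_linear with
  | zero => exact ⟨0, by rintro _ ⟨_, ⟨p, -, rfl⟩, rfl⟩; simp⟩
  | add x y hx hy =>
    obtain ⟨a, ha⟩ := hx
    obtain ⟨b, hb⟩ := hy
    refine ⟨a + b, ?_⟩
    rintro _ ⟨_, ⟨p, hp, rfl⟩, rfl⟩
    exact (map_add_le_add p x y).trans
      (add_le_add (ha ⟨_, ⟨p, hp, rfl⟩, rfl⟩) (hb ⟨_, ⟨p, hp, rfl⟩, rfl⟩))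
  | single g c =>
    refine ⟨‖c‖, ?_⟩
    rintro _ ⟨_, ⟨p, hp, rfl⟩, rfl⟩
    have : (MonoidAlgebra.single g c : FreeUnitaryAlg) = c • MonoidAlgebra.single g 1 := by
      simp
    simp only [Function.eval]
    rw [this, map_smul_eq_mul]
    exact mul_le_of_le_one_right (norm_nonneg _) (IsSoftSeminorm.single_le hp g)

theorem IsSoftSeminorm.le_softSeminorm {ε : ℝ} {p : Seminorm ℂ FreeUnitaryAlg}
    (hp : IsSoftSeminorm ε p) (x : FreeUnitaryAlg) : p x ≤ softSeminorm ε x :=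
  le_csSup (bddAbove_isSoftSeminorm ε) hp x

theorem softSeminorm_le {ε : ℝ} {x : FreeUnitaryAlg} {a : ℝ} (ha : 0 ≤ a)
    (h : ∀ p, IsSoftSeminorm ε p → p x ≤ a) : softSeminorm ε x ≤ a := by
  rw [softSeminorm, Seminorm.sSup_apply (bddAbove_isSoftSeminorm ε)]
  exact Real.iSup_le (fun p => h p.1 p.2) ha

theorem softSeminorm_mul_le (ε : ℝ) (x y : FreeUnitaryAlg) :
    softSeminorm ε (x * y) ≤ softSeminorm ε x * softSeminorm ε y := by
  refine softSeminorm_le (by positivity) fun p hp => (hp.mul_le x y).trans ?_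
  exact mul_le_mul (hp.le_softSeminorm x) (hp.le_softSeminorm y) (by positivity) (by positivity)

theorem softSeminorm_star_le (ε : ℝ) (x : FreeUnitaryAlg) :
    softSeminorm ε (star x) ≤ softSeminorm ε x :=
  softSeminorm_le (by positivity) fun p hp => (hp.map_star x).trans_le (hp.le_softSeminorm x)

theorem softSeminorm_mul_self_le (ε : ℝ) (x : FreeUnitaryAlg) :
    softSeminorm ε x * softSeminorm ε x ≤ softSeminorm ε (star x * x) := by
  have h0 : 0 ≤ softSeminorm ε (star x * x) := by positivity
  have : softSeminorm ε x ≤ √(softSeminorm ε (star x * x)) := by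
    refine softSeminorm_le (by positivity) fun p hp => Real.le_sqrt_of_sq_le ?_
    rw [sq, ← hp.star_mul_self]
    exact hp.le_softSeminorm _
  calc _ ≤ √(softSeminorm ε (star x * x)) * √(softSeminorm ε (star x * x)) := by gcongr
    _ = _ := Real.mul_self_sqrt h0

/-- The free `*`-algebra on two unitaries, regarded as a seminormed `*`-algebra with respect to
the seminorm `softSeminorm ε`. -/
def PreSoftTorus (_ε : ℝ) : Type := FreeUnitaryAlg

namespace PreSoftTorus

variable (ε : ℝ)

instance : Ring (PreSoftTorus ε) := inferInstanceAs (Ring FreeUnitaryAlg)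
instance : Algebra ℂ (PreSoftTorus ε) := inferInstanceAs (Algebra ℂ FreeUnitaryAlg)
instance : StarRing (PreSoftTorus ε) := inferInstanceAs (StarRing FreeUnitaryAlg)
instance : StarModule ℂ (PreSoftTorus ε) := inferInstanceAs (StarModule ℂ FreeUnitaryAlg)

/-- The identity map. -/
def of : FreeUnitaryAlg ≃⋆ₐ[ℂ] PreSoftTorus ε := StarAlgEquiv.refl (R := ℂ) (A := FreeUnitaryAlg)

instance : SeminormedAddCommGroup (PreSoftTorus ε) :=
  AddGroupSeminorm.toSeminormedAddCommGroup (E := PreSoftTorus ε)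
    (softSeminorm ε).toAddGroupSeminorm

instance : SeminormedRing (PreSoftTorus ε) where
  __ := (inferInstance : SeminormedAddCommGroup (PreSoftTorus ε))
  __ := (inferInstance : Ring (PreSoftTorus ε))
  norm_mul_le := softSeminorm_mul_le ε

theorem norm_of (x : FreeUnitaryAlg) : ‖of ε x‖ = softSeminorm ε x := rfl

instance : NormedAlgebra ℂ (PreSoftTorus ε) where
  norm_smul_le a x := (map_smul_eq_mul (softSeminorm ε) a x).le

instance : NormedStarGroup (PreSoftTorus ε) where
  norm_star_le := softSeminorm_star_le ε

theorem norm_mul_self_le (x : PreSoftTorus ε) : ‖x‖ * ‖x‖ ≤ ‖star x * x‖ :=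
  softSeminorm_mul_self_le ε x

end PreSoftTorus

/-- The soft torus `A_ε`: the Hausdorff completion of the free `*`-algebra on two unitaries
`u, v` with respect to the largest `C*`-seminorm for which the norm of `u v - v u` is at
most `ε`. -/
abbrev SoftTorus (ε : ℝ) : Type := UniformSpace.Completion (PreSoftTorus ε)

namespace SoftTorus

open UniformSpace

variable (ε : ℝ)

theorem uniformContinuous_star_pre : UniformContinuous (star : PreSoftTorus ε → PreSoftTorus ε) :=
  (starₗᵢ ℂ (E := PreSoftTorus ε)).isometry.uniformContinuous

instance : Star (SoftTorus ε) := ⟨Completion.map star⟩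

theorem coe_star (x : PreSoftTorus ε) : ((star x : PreSoftTorus ε) : SoftTorus ε) = star ↑x :=
  (Completion.map_coe (uniformContinuous_star_pre ε) x).symm

theorem continuous_star_completion : Continuous (star : SoftTorus ε → SoftTorus ε) :=
  Completion.continuous_map

instance : StarRing (SoftTorus ε) where
  star_involutive x := by
    have hc := continuous_star_completion ε
    induction x using Completion.induction_on with
    | hp => exact isClosed_eq (by fun_prop) (by fun_prop)
    | ih x => rw [← coe_star, ← coe_star, star_star]
  star_mul x y := by
    have hc := continuous_star_completion ε
    induction x, y using Completion.induction_on₂ with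
    | hp => exact isClosed_eq (by fun_prop) (by fun_prop)
    | ih x y =>
      rw [← Completion.coe_mul, ← coe_star, star_mul, Completion.coe_mul, coe_star, coe_star]
  star_add x y := by
    have hc := continuous_star_completion ε
    induction x, y using Completion.induction_on₂ with
    | hp => exact isClosed_eq (by fun_prop) (by fun_prop)
    | ih x y =>
      rw [← Completion.coe_add, ← coe_star, star_add, Completion.coe_add, coe_star, coe_star]

theorem norm_mul_self_le (x : SoftTorus ε) : ‖x‖ * ‖x‖ ≤ ‖star x * x‖ := by
  have hc := continuous_star_completion ε
  induction x using Completion.induction_on with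
  | hp => exact isClosed_le (by fun_prop) (continuous_norm.comp (hc.mul continuous_id))
  | ih x =>
    rw [← coe_star, ← Completion.coe_mul, Completion.norm_coe, Completion.norm_coe]
    exact PreSoftTorus.norm_mul_self_le ε x

instance : CStarRing (SoftTorus ε) := ⟨fun x => norm_mul_self_le ε x⟩

instance : NormedAlgebra ℂ (SoftTorus ε) where
  norm_smul_le := norm_smul_le

instance : StarModule ℂ (SoftTorus ε) where
  star_smul a x := by
    have hc := continuous_star_completion ε
    induction x using Completion.induction_on with
    | hp => exact isClosed_eq (hc.comp (continuous_const_smul a)) (hc.const_smul (star a))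
    | ih x => rw [← Completion.coe_smul, ← coe_star, star_smul, Completion.coe_smul, coe_star]

instance : CStarAlgebra (SoftTorus ε) where

/-- The canonical `*`-homomorphism from the free `*`-algebra on two unitaries to the soft torus. -/
def ofFree : FreeUnitaryAlg →⋆ₐ[ℂ] SoftTorus ε where
  toFun x := (PreSoftTorus.of ε x : SoftTorus ε)
  map_one' := Completion.coe_one _
  map_mul' x y := Completion.coe_mul (PreSoftTorus.of ε x) (PreSoftTorus.of ε y)
  map_zero' := Completion.coe_zero
  map_add' x y := Completion.coe_add (PreSoftTorus.of ε x) (PreSoftTorus.of ε y)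
  commutes' _ := rfl
  map_star' x := coe_star ε (PreSoftTorus.of ε x)

theorem norm_ofFree (x : FreeUnitaryAlg) : ‖ofFree ε x‖ = softSeminorm ε x :=
  Completion.norm_coe (PreSoftTorus.of ε x)

theorem denseRange_ofFree : DenseRange (ofFree ε) :=
  Completion.denseRange_coe (α := PreSoftTorus ε)

/-- The first canonical unitary generator of the soft torus. -/
def u : SoftTorus ε := ofFree ε FreeUnitaryAlg.u

/-- The second canonical unitary generator of the soft torus. -/
def v : SoftTorus ε := ofFree ε FreeUnitaryAlg.v

theorem u_mem_unitary : u ε ∈ unitary (SoftTorus ε) := by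
  constructor
  · rw [u, ← map_star, ← map_mul, FreeUnitaryAlg.u, FreeUnitaryAlg.star_mul_self_single, map_one]
  · rw [u, ← map_star, ← map_mul, FreeUnitaryAlg.u, FreeUnitaryAlg.self_mul_star_single, map_one]

theorem v_mem_unitary : v ε ∈ unitary (SoftTorus ε) := by
  constructor
  · rw [v, ← map_star, ← map_mul, FreeUnitaryAlg.v, FreeUnitaryAlg.star_mul_self_single, map_one]
  · rw [v, ← map_star, ← map_mul, FreeUnitaryAlg.v, FreeUnitaryAlg.self_mul_star_single, map_one]

variable {ε}

theorem norm_comm_le (hε : 0 ≤ ε) : ‖u ε * v ε - v ε * u ε‖ ≤ ε := by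
  rw [u, v, ← map_mul, ← map_mul, ← map_sub, norm_ofFree]
  exact softSeminorm_le hε fun p hp => hp.comm_le

/-- The universal property of the soft torus: any two unitaries `U`, `V` in a unital `C*`-algebra
with `‖U V - V U‖ ≤ ε` are the images of `u`, `v` under a unique unital `*`-homomorphism. -/
theorem existsUnique_starAlgHom {D : Type*} [CStarAlgebra D] {U V : D} (hU : U ∈ unitary D)
    (hV : V ∈ unitary D) (h : ‖U * V - V * U‖ ≤ ε) :
    ∃! φ : SoftTorus ε →⋆ₐ[ℂ] D, φ (u ε) = U ∧ φ (v ε) = V := by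
  let ψ : FreeUnitaryAlg →⋆ₐ[ℂ] D := FreeUnitaryAlg.lift ⟨U, hU⟩ ⟨V, hV⟩
  let f : PreSoftTorus ε →+* D := ((ψ : FreeUnitaryAlg →ₐ[ℂ] D) : FreeUnitaryAlg →+* D)
  have hf : Continuous f := by
    refine AddMonoidHomClass.continuous_of_bound f 1 fun x => ?_
    rw [one_mul]
    exact (IsSoftSeminorm.norm_lift ⟨U, hU⟩ ⟨V, hV⟩ h).le_softSeminorm x
  let F := Completion.extensionHom f hf
  have hFc : Continuous F := Completion.continuous_extension
  have hF : ∀ x, F (ofFree ε x) = ψ x := fun x => Completion.extensionHom_coe f hf _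
  let Φ : SoftTorus ε →⋆ₐ[ℂ] D :=
    { F with
      commutes' := fun r => by
        have := hF (algebraMap ℂ _ r)
        rw [AlgHomClass.commutes ψ, AlgHomClass.commutes (ofFree ε)] at this
        exact this
      map_star' := fun x => by
        have hc := continuous_star_completion ε
        change F (star x) = star (F x)
        induction x using (denseRange_ofFree ε).induction_on with
        | hp => exact isClosed_eq (by fun_prop) (by fun_prop)
        | ih x => rw [← map_star, hF, hF, map_star] }
  refine ⟨Φ, ⟨(hF _).trans (FreeUnitaryAlg.lift_u _ _), (hF _).trans (FreeUnitaryAlg.lift_v _ _)⟩,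
    ?_⟩
  rintro φ ⟨hu, hv⟩
  have key : φ.comp (ofFree ε) = ψ :=
    FreeUnitaryAlg.hom_ext (hu.trans (FreeUnitaryAlg.lift_u ⟨U, hU⟩ ⟨V, hV⟩).symm)
      (hv.trans (FreeUnitaryAlg.lift_v ⟨U, hU⟩ ⟨V, hV⟩).symm)
  have hφ : Continuous φ := AddMonoidHomClass.continuous_of_bound φ 1 fun x => by
    simpa using NonUnitalStarAlgHom.norm_apply_le φ x
  apply DFunLike.coe_injective
  refine (denseRange_ofFree ε).equalizer hφ hFc ?_
  funext x
  exact (DFunLike.congr_fun key x).trans (hF x).symm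

end SoftTorus

/-! ### Residual finite dimensionality -/

universe w

/-- A unital `C*`-algebra is residually finite dimensional if it has a separating family of
representations on finite-dimensional Hilbert spaces. -/
def IsResiduallyFiniteDimensional (A : Type w) [CStarAlgebra A] : Prop :=
  ∃ (ι : Type w) (n : ι → ℕ)
    (π : ∀ i, A →⋆ₐ[ℂ] (EuclideanSpace ℂ (Fin (n i)) →L[ℂ] EuclideanSpace ℂ (Fin (n i)))),
    ∀ a : A, (∀ i, π i a = 0) → a = 0

end

open Filter Topology

/-! By GNS, a nonzero `a` is nonzero in some representation on a Hilbert space `H`, with unitaries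
`U`, `V` satisfying `‖UV - VU‖ ≤ ε`. It remains to approximate that representation by
finite-dimensional ones.

The conjugates `g k = V⁻ᵏ U Vᵏ` form a sequence of unitaries whose steps have norm `‖UV - VU‖ ≤ ε`.
Conversely, a unitary sequence with steps at most `ε`, placed around a cycle, gives a
representation: `u` is the diagonal unitary and `v` the cyclic shift. To close up the cycle, the
sequence is run up to index `m + 1` and back down again. The vector `ξ` is modelled by the
components `(m + 1)^(-1/2) V⁻ᵏ ξ` for `k ≤ m`. This intertwines `u` exactly and `v` up to two
boundary terms of order `(m + 1)^(-1/2)`.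

The cycle makes the number of blocks finite; the blocks must become finite-dimensional too, without
enlarging the steps. Cutting each `g k` down separately loses the step bound, so the increments `(g
k)⁻¹ g (k + 1)` are approximated instead (`exists_strongTendsto_unitary_norm_sub_one_le`) and
multiplied up (`exists_strongTendsto_unitary_seq`). An increment `w` with `‖w - 1‖ < 2` is `exp (i
h)` with `‖h‖ ≤ π`. Compressing `h` does not increase `‖h‖`, hence does not increase `‖exp (i h) -
1‖`.

Asymptotic intertwining passes from the generators to all of the soft torus
(`SoftTorus.mem_asymptoticIntertwiners`). If every model killed `a`, then `‖ρ a ξ‖` would be a limit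
of zeros. -/

theorem norm_le_one_of_mem_unitary {A : Type*} [NormedRing A] [StarRing A] [CStarRing A] {a : A}
    (ha : a ∈ unitary A) : ‖a‖ ≤ 1 := by
  nontriviality A
  exact (CStarRing.norm_of_mem_unitary ha).le

/-! ### Separating representations of `C*`-algebras -/

section GNS

open scoped ComplexOrder

/-- For every nonzero `a` in a `C*`-algebra there is a positive functional `f` with
`f (star a * a) ≠ 0`. -/
theorem exists_positiveLinearMap_apply_ne_zero {A : Type*} [CStarAlgebra A] [PartialOrder A]
    [StarOrderedRing A] {a : A} (ha : a ≠ 0) : ∃ f : A →ₚ[ℂ] ℂ, f (star a * a) ≠ 0 := by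
  let C : ProperCone ℝ A :=
    { carrier := {x | 0 ≤ x}
      add_mem' := fun hx hy => add_nonneg hx hy
      zero_mem' := le_rfl
      smul_mem' := fun c x hx => smul_nonneg (α := ℝ) c.2 hx
      isClosed' := CStarAlgebra.isClosed_nonneg }
  -- The positive cone is closed and contains no line, so Hahn–Banach separates `-(star a * a)` from
  -- it.
  have hC : -(star a * a) ∉ C := fun h => by
    have h1 : 0 ≤ -(star a * a) := h
    have h2 : star a * a = 0 := le_antisymm (by simpa using h1) (star_mul_self_nonneg a)
    exact ha (CStarRing.star_mul_self_eq_zero_iff a |>.mp h2)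
  obtain ⟨g, hg, hga⟩ := C.hyperplane_separation_point hC
  -- Complex-linear extension of the real functional `g` restricted to the self-adjoint part.
  let φ : A →ₗ[ℂ] ℂ :=
    { toFun := fun x => (g (realPart x : A) : ℂ) + Complex.I * g (imaginaryPart x : A)
      map_add' := fun x y => by simp; ring
      map_smul' := fun c x => by
        apply Complex.ext <;> simp [realPart_smul, imaginaryPart_smul] }
  have hφ : ∀ x : A, 0 ≤ x → φ x = g x := fun x hx => by
    have hs : IsSelfAdjoint x := .of_nonneg hx
    simp [φ, hs.coe_realPart, hs.imaginaryPart]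
  refine ⟨.mk₀ φ fun x hx => ?_, ?_⟩
  · rw [hφ x hx]
    exact_mod_cast hg x hx
  · change φ (star a * a) ≠ 0
    rw [hφ _ (star_mul_self_nonneg a)]
    rw [map_neg] at hga
    exact_mod_cast (by linarith : g (star a * a) > 0).ne'

/-- Every nonzero element of a `C*`-algebra acts nontrivially in some representation on a Hilbert
space. -/
theorem exists_starAlgHom_apply_ne_zero {A : Type w} [CStarAlgebra A] {a : A} (ha : a ≠ 0) :
    ∃ (H : Type w) (_ : NormedAddCommGroup H) (_ : InnerProductSpace ℂ H) (_ : CompleteSpace H)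
      (ρ : A →⋆ₐ[ℂ] (H →L[ℂ] H)), ρ a ≠ 0 := by
  let _ := CStarAlgebra.spectralOrder A
  have := CStarAlgebra.spectralOrderedRing A
  obtain ⟨f, hf⟩ := exists_positiveLinearMap_apply_ne_zero ha
  refine ⟨f.GNS, inferInstance, inferInstance, inferInstance, f.gnsStarAlgHom, fun h => hf ?_⟩
  -- The cyclic vector, the class of `1`, detects `a`: it is sent to the class of `a`, whose squared
  -- norm is `f (star a * a)`.
  have h1 : f.gnsStarAlgHom a (f.toPreGNS 1 : f.GNS) = 0 := by rw [h]; rfl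
  have h2 : f.gnsStarAlgHom a (f.toPreGNS 1 : f.GNS) = (f.toPreGNS a : f.GNS) := by
    change f.gnsNonUnitalStarAlgHom a _ = _
    rw [f.gnsNonUnitalStarAlgHom_apply_coe]
    simp
  rw [h2] at h1
  have h3 := f.preGNS_norm_sq (f.toPreGNS a)
  rw [← UniformSpace.Completion.norm_coe, h1] at h3
  simpa using h3.symm

end GNS

/-! ### Residual finite dimensionality from finite-dimensional Hilbert spaces -/

theorem isResiduallyFiniteDimensional_of_forall_exists {A : Type*} [CStarAlgebra A]
    (h : ∀ a : A, a ≠ 0 → ∃ (E : Type) (_ : NormedAddCommGroup E) (_ : InnerProductSpace ℂ E)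
      (_ : FiniteDimensional ℂ E) (_ : CompleteSpace E) (π : A →⋆ₐ[ℂ] (E →L[ℂ] E)), π a ≠ 0) :
    IsResiduallyFiniteDimensional A := by
  refine ⟨Σ n, A →⋆ₐ[ℂ] (EuclideanSpace ℂ (Fin n) →L[ℂ] EuclideanSpace ℂ (Fin n)),
    Sigma.fst, Sigma.snd, fun a ha => ?_⟩
  by_contra h0
  obtain ⟨E, _, _, _, _, π, hπ⟩ := h a h0
  let e := (stdOrthonormalBasis ℂ E).repr.conjStarAlgEquiv
  refine hπ (e.injective ?_)
  rw [map_zero]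
  exact ha ⟨_, e.toStarAlgHom.comp π⟩

/-! ### Asymptotically intertwining representations -/

section Intertwining

variable {ι : Type*} {A H : Type*} [CStarAlgebra A]
  [NormedAddCommGroup H] [InnerProductSpace ℂ H] [CompleteSpace H]
  {E : ι → Type*} [∀ i, NormedAddCommGroup (E i)] [∀ i, InnerProductSpace ℂ (E i)]
  [∀ i, CompleteSpace (E i)]

/-- The elements of `A` whose actions by `ρ` and by `π i` are asymptotically intertwined by
`W i`. -/
def asymptoticIntertwiners (l : Filter ι) (ρ : A →⋆ₐ[ℂ] (H →L[ℂ] H))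
    (π : ∀ i, A →⋆ₐ[ℂ] (E i →L[ℂ] E i)) (W : ∀ i, H →L[ℂ] E i) :
    Subalgebra ℂ A where
  carrier := {a | ∀ ξ, Tendsto (fun i => ‖π i a (W i ξ) - W i (ρ a ξ)‖) l (𝓝 0)}
  mul_mem' {a b} ha hb ξ := by
    have h1 := ((hb ξ).const_mul ‖a‖).add (ha (ρ b ξ))
    rw [mul_zero, add_zero] at h1
    refine squeeze_zero (fun i => norm_nonneg _) (fun i => ?_) h1
    have h2 : π i (a * b) (W i ξ) - W i (ρ (a * b) ξ) =
        π i a (π i b (W i ξ) - W i (ρ b ξ)) + (π i a (W i (ρ b ξ)) - W i (ρ a (ρ b ξ))) := by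
      simp
    rw [h2]
    refine (norm_add_le _ _).trans (add_le_add_left ?_ _)
    exact (π i a).le_of_opNorm_le (NonUnitalStarAlgHom.norm_apply_le (π i) a) _
  add_mem' {a b} ha hb ξ := by
    have h1 := (ha ξ).add (hb ξ)
    rw [add_zero] at h1
    refine squeeze_zero (fun i => norm_nonneg _) (fun i => ?_) h1
    refine le_trans (le_of_eq ?_) (norm_add_le _ _)
    simp only [map_add, add_apply]
    congr 1
    abel
  algebraMap_mem' c ξ := by
    simpa [Algebra.algebraMap_eq_smul_one] using tendsto_const_nhds

variable {l : Filter ι} {ρ : A →⋆ₐ[ℂ] (H →L[ℂ] H)} {π : ∀ i, A →⋆ₐ[ℂ] (E i →L[ℂ] E i)}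
  {W : ∀ i, H →L[ℂ] E i}

/-- The defining condition is not symmetric under adjoints. For a unitary `a`, however, the error of
`star a` at `ξ` is the image under `-π i (star a)` of the error of `a` at `ρ (star a) ξ`. -/
theorem star_mem_asymptoticIntertwiners {a : A} (ha : a ∈ unitary A)
    (h : a ∈ asymptoticIntertwiners l ρ π W) :
    star a ∈ asymptoticIntertwiners l ρ π W := fun ξ => by
  refine squeeze_zero (fun i => norm_nonneg _) (fun i => ?_) (h (ρ (star a) ξ))
  have h1 : π i (star a) (W i ξ) - W i (ρ (star a) ξ) =
      - π i (star a) (π i a (W i (ρ (star a) ξ)) - W i (ρ a (ρ (star a) ξ))) := by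
    simp only [map_sub, ← mul_apply_eq_comp, ← map_mul, Unitary.star_mul_self_of_mem ha,
      Unitary.mul_star_self_of_mem ha, map_one]
    simp
  rw [h1, norm_neg]
  refine ((π i (star a)).le_of_opNorm_le (NonUnitalStarAlgHom.norm_apply_le (π i) _) _).trans ?_
  refine mul_le_of_le_one_left (norm_nonneg _) ?_
  rw [norm_star]
  exact norm_le_one_of_mem_unitary ha

theorem isClosed_asymptoticIntertwiners (hW : ∀ i, ‖W i‖ ≤ 1) :
    IsClosed (asymptoticIntertwiners l ρ π W : Set A) := by
  refine isClosed_of_closure_subset fun a ha ξ => ?_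
  rw [Metric.tendsto_nhds]
  intro δ hδ
  -- Replacing `a` by `b` costs `‖a - b‖ * ‖ξ‖` on each side; the `+ 1` keeps the denominator
  -- positive when `ξ = 0`.
  obtain ⟨b, hb, hab⟩ := Metric.mem_closure_iff.mp ha (δ / (2 * (‖ξ‖ + ‖ξ‖ + 1))) (by positivity)
  rw [dist_eq_norm, lt_div_iff₀ (by positivity)] at hab
  filter_upwards [(Metric.tendsto_nhds.mp (hb ξ)) (δ / 2) (half_pos hδ)] with i hi
  rw [Real.dist_0_eq_abs, abs_norm] at hi ⊢
  have h1 : π i a (W i ξ) - W i (ρ a ξ) =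
      (π i b (W i ξ) - W i (ρ b ξ)) + π i (a - b) (W i ξ) - W i (ρ (a - b) ξ) := by
    simp
  have hWi : ∀ η, ‖W i η‖ ≤ ‖η‖ := fun η => by
    simpa using (W i).le_of_opNorm_le (hW i) η
  have h2 : ‖π i (a - b) (W i ξ)‖ ≤ ‖a - b‖ * ‖ξ‖ :=
    ((π i _).le_of_opNorm_le (NonUnitalStarAlgHom.norm_apply_le (π i) _) _).trans
      (by gcongr; exact hWi ξ)
  have h3 : ‖W i (ρ (a - b) ξ)‖ ≤ ‖a - b‖ * ‖ξ‖ :=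
    (hWi _).trans ((ρ _).le_of_opNorm_le (NonUnitalStarAlgHom.norm_apply_le ρ _) _)
  rw [h1]
  have h4 := norm_sub_le (π i b (W i ξ) - W i (ρ b ξ) + π i (a - b) (W i ξ)) (W i (ρ (a - b) ξ))
  have h5 := norm_add_le (π i b (W i ξ) - W i (ρ b ξ)) (π i (a - b) (W i ξ))
  nlinarith [norm_nonneg (a - b)]

end Intertwining

/-- If the two canonical generators are asymptotically intertwined, then so is every element. -/
theorem SoftTorus.mem_asymptoticIntertwiners {ι : Type*} {ε : ℝ} {H : Type*}
    [NormedAddCommGroup H] [InnerProductSpace ℂ H] [CompleteSpace H]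
    {E : ι → Type*} [∀ i, NormedAddCommGroup (E i)] [∀ i, InnerProductSpace ℂ (E i)]
    [∀ i, CompleteSpace (E i)] {l : Filter ι} {ρ : SoftTorus ε →⋆ₐ[ℂ] (H →L[ℂ] H)}
    {π : ∀ i, SoftTorus ε →⋆ₐ[ℂ] (E i →L[ℂ] E i)} {W : ∀ i, H →L[ℂ] E i} (hW : ∀ i, ‖W i‖ ≤ 1)
    (hu : u ε ∈ asymptoticIntertwiners l ρ π W) (hv : v ε ∈ asymptoticIntertwiners l ρ π W)
    (a : SoftTorus ε) : a ∈ asymptoticIntertwiners l ρ π W := by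
  have hg : ∀ g : FreeGroup (Fin 2), ofFree ε (MonoidAlgebra.single g 1) ∈
      asymptoticIntertwiners l ρ π W := fun g => by
    have hgen : ∀ i : Fin 2, ofFree ε (MonoidAlgebra.single (FreeGroup.of i) 1) ∈
      asymptoticIntertwiners l ρ π W := fun i => by
      fin_cases i
      exacts [hu, hv]
    induction g using FreeGroup.induction_on with
    | C1 =>
      rw [← MonoidAlgebra.one_def, map_one]
      exact one_mem _
    | of i => exact hgen i
    | inv_of i h =>
      have h1 := star_mem_asymptoticIntertwiners ?_ h
      · rwa [← map_star, FreeUnitaryAlg.star_single, star_one] at h1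
      · constructor
        · rw [← map_star, ← map_mul, FreeUnitaryAlg.star_mul_self_single, map_one]
        · rw [← map_star, ← map_mul, FreeUnitaryAlg.self_mul_star_single, map_one]
    | mul g h hg hh =>
      have h1 := mul_mem hg hh
      rwa [← map_mul, MonoidAlgebra.single_mul_single, one_mul] at h1
  induction a using (denseRange_ofFree ε).induction_on with
  | hp => exact isClosed_asymptoticIntertwiners hW
  | ih x =>
    induction x using MonoidAlgebra.induction_linear with
    | zero => rw [map_zero]; exact zero_mem _
    | add x y hx hy => rw [map_add]; exact add_mem hx hy
    | single g c =>
      have h1 : (MonoidAlgebra.single g c : FreeUnitaryAlg) = c • MonoidAlgebra.single g 1 := by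
        simp
      rw [h1, map_smul]
      exact Subalgebra.smul_mem _ (hg g) c

/-! ### Strong approximation of unitaries by unitaries on finite-dimensional spaces -/

section StrongApproximation

open ContinuousLinearMap (adjoint)

variable {ι : Type*} {H : Type*} [NormedAddCommGroup H] [InnerProductSpace ℂ H] [CompleteSpace H]
  {K : ι → Type*} [∀ i, NormedAddCommGroup (K i)] [∀ i, InnerProductSpace ℂ (K i)]
  [∀ i, CompleteSpace (K i)]

/-- The orthogonal projection onto the range of an isometry, as a map to its domain. -/
noncomputable def LinearIsometry.coisometry {E : Type*} [NormedAddCommGroup E]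
    [InnerProductSpace ℂ E] [CompleteSpace E] (J : E →ₗᵢ[ℂ] H) : H →L[ℂ] E :=
  adjoint J.toContinuousLinearMap

namespace LinearIsometry

variable {E : Type*} [NormedAddCommGroup E] [InnerProductSpace ℂ E] [CompleteSpace E]
  (J : E →ₗᵢ[ℂ] H)

theorem coisometry_apply (x : E) : J.coisometry (J x) = x := by
  refine ext_inner_left ℂ fun y => ?_
  rw [coisometry, ContinuousLinearMap.adjoint_inner_right]
  exact J.inner_map_map y x

theorem norm_coisometry_le : ‖J.coisometry‖ ≤ 1 := by
  rw [coisometry, LinearIsometryEquiv.norm_map]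
  exact J.norm_toContinuousLinearMap_le

theorem norm_coisometry_apply_le (x : H) : ‖J.coisometry x‖ ≤ ‖x‖ := by
  simpa using J.coisometry.le_of_opNorm_le J.norm_coisometry_le x

/-- The compression of an operator along an isometry. -/
noncomputable def compression (t : H →L[ℂ] H) : E →L[ℂ] E :=
  J.coisometry ∘L t ∘L J.toContinuousLinearMap

theorem norm_compression_le (t : H →L[ℂ] H) : ‖J.compression t‖ ≤ ‖t‖ :=
  ContinuousLinearMap.opNorm_le_bound _ (norm_nonneg _) fun x =>
    (J.norm_coisometry_apply_le _).trans (by simpa using t.le_opNorm (J x))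

theorem isSelfAdjoint_compression {t : H →L[ℂ] H} (ht : IsSelfAdjoint t) :
    IsSelfAdjoint (J.compression t) :=
  ht.adjoint_conj J.toContinuousLinearMap

end LinearIsometry

/-- The net of operators `T i`, acting on spaces embedded in `H` by isometries `J i`, converges
strongly to `t`. -/
def StrongTendsto (l : Filter ι) (J : ∀ i, K i →ₗᵢ[ℂ] H) (T : ∀ i, K i →L[ℂ] K i)
    (t : H →L[ℂ] H) : Prop :=
  ∀ ξ : H, Tendsto (fun i => J i (T i ((J i).coisometry ξ))) l (𝓝 (t ξ))

variable {l : Filter ι} {J : ∀ i, K i →ₗᵢ[ℂ] H} (hJ : ∀ ξ, ∀ᶠ i in l, ξ ∈ Set.range (J i))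

include hJ in
theorem tendsto_norm_coisometry (ξ : H) :
    Tendsto (fun i => ‖(J i).coisometry ξ‖) l (𝓝 ‖ξ‖) := by
  refine tendsto_const_nhds.congr' ?_
  filter_upwards [hJ ξ] with i ⟨x, hx⟩
  rw [← hx, LinearIsometry.coisometry_apply, LinearIsometry.norm_map]

namespace StrongTendsto

variable {S T : ∀ i, K i →L[ℂ] K i} {s t : H →L[ℂ] H}

theorem tendsto_norm_sub (h : StrongTendsto l J T t) (ξ : H) :
    Tendsto (fun i => ‖T i ((J i).coisometry ξ) - (J i).coisometry (t ξ)‖) l (𝓝 0) := by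
  refine squeeze_zero (fun i => norm_nonneg _) (fun i => ?_)
    (tendsto_iff_norm_sub_tendsto_zero.mp (h ξ))
  have h1 := (J i).norm_coisometry_apply_le (J i (T i ((J i).coisometry ξ)) - t ξ)
  rwa [map_sub, LinearIsometry.coisometry_apply] at h1

include hJ in
theorem one : StrongTendsto l J (fun _ => 1) 1 := fun ξ => by
  refine tendsto_const_nhds.congr' ?_
  filter_upwards [hJ ξ] with i ⟨x, hx⟩
  simp [← hx, LinearIsometry.coisometry_apply]

/-- Multiplication is jointly strongly continuous only on bounded sets, hence the uniform bound on
the left factors. -/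
theorem mul {C : ℝ} (hC : ∀ i, ‖T i‖ ≤ C) (hT : StrongTendsto l J T t)
    (hS : StrongTendsto l J S s) : StrongTendsto l J (fun i => T i * S i) (t * s) := fun ξ => by
  have h1 := (hS.tendsto_norm_sub ξ).const_mul C
  have h2 : Tendsto (fun i => J i (T i (S i ((J i).coisometry ξ) - (J i).coisometry (s ξ))))
      l (𝓝 0) := by
    rw [mul_zero] at h1
    refine squeeze_zero_norm (fun i => ?_) h1
    rw [LinearIsometry.norm_map]
    exact (T i).le_of_opNorm_le (hC i) _
  have h3 := h2.add (hT (s ξ))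
  rw [zero_add] at h3
  refine h3.congr fun i => ?_
  simp

theorem smul (c : ℂ) (hT : StrongTendsto l J T t) :
    StrongTendsto l J (fun i => c • T i) (c • t) := fun ξ => by
  simpa using (hT ξ).const_smul c

include hJ in
theorem pow {C : ℝ} (hC : ∀ i, ‖T i‖ ≤ C) (hT : StrongTendsto l J T t) (n : ℕ) :
    StrongTendsto l J (fun i => T i ^ n) (t ^ n) := by
  induction n with
  | zero => simpa using StrongTendsto.one hJ
  | succ n ih =>
    simp only [pow_succ']
    exact hT.mul hC ih

end StrongTendsto

theorem apply_exp_apply {E F : Type*} [NormedAddCommGroup E] [NormedSpace ℂ E] [CompleteSpace E]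
    [NormedAddCommGroup F] [NormedSpace ℂ F] (f : E →L[ℂ] F) (s : E →L[ℂ] E) (η : E) :
    f (NormedSpace.exp s η) = ∑' n : ℕ, (n.factorial : ℂ)⁻¹ • f ((s ^ n) η) := by
  have h1 := (NormedSpace.exp_series_hasSum_exp' (𝕂 := ℂ) s).mapL
    (f.comp (ContinuousLinearMap.apply ℂ E η))
  simpa using h1.tsum_eq.symm

-- The powers converge strongly term by term, and `C ^ n / n! * ‖ξ‖` dominates the exponential
-- series uniformly in `i`.
include hJ in
theorem StrongTendsto.exp {T : ∀ i, K i →L[ℂ] K i} {t : H →L[ℂ] H} {C : ℝ} (hC₀ : 0 ≤ C)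
    (hC : ∀ i, ‖T i‖ ≤ C) (hT : StrongTendsto l J T t) :
    StrongTendsto l J (fun i => NormedSpace.exp (T i)) (NormedSpace.exp t) := fun ξ => by
  have h1 := apply_exp_apply (.id ℂ H) t ξ
  have h2 := fun i => apply_exp_apply (J i).toContinuousLinearMap (T i) ((J i).coisometry ξ)
  simp only [ContinuousLinearMap.id_apply, LinearIsometry.coe_toContinuousLinearMap] at h1 h2
  rw [h1]
  simp_rw [h2]
  refine tendsto_tsum_of_dominated_convergence
    (bound := fun n => C ^ n / n.factorial * ‖ξ‖) ((Real.summable_pow_div_factorial C).mul_right _)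
    (fun n => (hT.pow hJ hC n ξ).const_smul _) (Eventually.of_forall fun i n => ?_)
  rw [norm_smul, norm_inv, RCLike.norm_natCast, div_mul_eq_mul_div, div_eq_inv_mul,
    LinearIsometry.norm_map]
  gcongr
  refine le_trans ?_ (mul_le_mul_of_nonneg_left ((J i).norm_coisometry_apply_le ξ)
    (pow_nonneg hC₀ n))
  induction n with
  | zero => simp
  | succ n ih =>
    rw [pow_succ', pow_succ', mul_assoc]
    exact ((T i).le_of_opNorm_le (hC i) _).trans (mul_le_mul_of_nonneg_left ih hC₀)

include hJ in
theorem strongTendsto_compression (t : H →L[ℂ] H) :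
    StrongTendsto l J (fun i => (J i).compression t) t := fun ξ => by
  refine tendsto_const_nhds.congr' ?_
  filter_upwards [hJ ξ, hJ (t ξ)] with i ⟨x, hx⟩ ⟨y, hy⟩
  rw [← hx] at hy
  simp [LinearIsometry.compression, ← hx, LinearIsometry.coisometry_apply, ← hy]

/-- Any unitary on `H` agrees, as far as possible, with a unitary on a given finite-dimensional
subspace. -/
theorem exists_unitary_extend {E : Type*} [NormedAddCommGroup E] [InnerProductSpace ℂ E]
    [CompleteSpace E] [FiniteDimensional ℂ E] (J : E →ₗᵢ[ℂ] H) (w : unitary (H →L[ℂ] H)) :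
    ∃ W : unitary (E →L[ℂ] E), ∀ x y : E,
      (w : H →L[ℂ] H) (J x) = J y → (W : E →L[ℂ] E) x = y := by
  let t : E →ₗᵢ[ℂ] H := (Unitary.linearIsometryEquiv w).toLinearIsometry.comp J
  -- `S` consists of the vectors that `w` keeps inside the subspace. On it `w` is an isometry into
  -- `E`, and by finite dimension it extends to a unitary of `E`.
  let S : Submodule ℂ E := (LinearMap.range J.toLinearMap).comap t.toLinearMap
  have hS : ∀ x : S, J (J.coisometry (t x)) = t x := fun x => by
    obtain ⟨y, hy⟩ := x.2
    have hy' : J y = t x := hy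
    rw [← hy', J.coisometry_apply]
  let L : S →ₗᵢ[ℂ] E :=
    { toLinearMap := J.coisometry.toLinearMap ∘ₗ t.toLinearMap ∘ₗ S.subtype
      norm_map' := fun x => by
        rw [← J.norm_map]
        exact (congrArg norm (hS x)).trans (t.norm_map x) }
  refine ⟨Unitary.linearIsometryEquiv.symm (L.extend.toLinearIsometryEquiv rfl), fun x y h => ?_⟩
  refine (L.extend_apply ⟨x, y, h.symm⟩).trans ?_
  change J.coisometry ((w : H →L[ℂ] H) (J x)) = y
  rw [h, J.coisometry_apply]

include hJ in
theorem exists_strongTendsto_unitary [∀ i, FiniteDimensional ℂ (K i)]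
    (w : unitary (H →L[ℂ] H)) :
    ∃ W : ∀ i, unitary (K i →L[ℂ] K i),
      StrongTendsto l J (fun i => (W i : K i →L[ℂ] K i)) w := by
  choose W hW using fun i => exists_unitary_extend (J i) w
  refine ⟨W, fun ξ => tendsto_const_nhds.congr' ?_⟩
  filter_upwards [hJ ξ, hJ ((w : H →L[ℂ] H) ξ)] with i ⟨x, hx⟩ ⟨y, hy⟩
  rw [← hx] at hy ⊢
  rw [LinearIsometry.coisometry_apply, hW i x y hy.symm, hy]

/-- For `‖x‖ ≤ π` one has `‖exp (i x) - 1‖² = 2 (1 - cos ‖x‖)`, which increases with `‖x‖`. -/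
theorem norm_expUnitary_sub_one_le_of_norm_le {A B : Type*} [CStarAlgebra A] [CStarAlgebra B]
    {x : selfAdjoint A} {y : selfAdjoint B} (hxy : ‖x‖ ≤ ‖y‖) (hy : ‖y‖ ≤ Real.pi) :
    ‖(selfAdjoint.expUnitary x - 1 : A)‖ ≤ ‖(selfAdjoint.expUnitary y - 1 : B)‖ := by
  rw [← sq_le_sq₀ (norm_nonneg _) (norm_nonneg _),
    selfAdjoint.norm_sq_expUnitary_sub_one (hxy.trans hy),
    selfAdjoint.norm_sq_expUnitary_sub_one hy]
  gcongr
  exact Real.cos_le_cos_of_nonneg_of_le_pi (norm_nonneg _) hy hxy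

include hJ in
/-- A unitary is the strong limit of unitaries on finite-dimensional spaces that are no further
from the identity. -/
theorem exists_strongTendsto_unitary_norm_sub_one_le [∀ i, FiniteDimensional ℂ (K i)]
    (w : unitary (H →L[ℂ] H)) :
    ∃ W : ∀ i, unitary (K i →L[ℂ] K i),
      (∀ i, ‖(W i - 1 : K i →L[ℂ] K i)‖ ≤ ‖(w - 1 : H →L[ℂ] H)‖) ∧
      StrongTendsto l J (fun i => (W i : K i →L[ℂ] K i)) w := by
  -- Below `2` the spectrum of `w` avoids `-1`, so `w` has a self-adjoint logarithm. Otherwise the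
  -- required bound is at least `2` and every unitary meets it.
  by_cases hw : ‖(w - 1 : H →L[ℂ] H)‖ < 2
  · obtain ⟨h, hh, rfl⟩ : ∃ h : selfAdjoint (H →L[ℂ] H), ‖h‖ ≤ Real.pi ∧
        selfAdjoint.expUnitary h = w :=
      ⟨_, Unitary.norm_argSelfAdjoint_le_pi w, expUnitary_argSelfAdjoint hw⟩
    refine ⟨fun i => selfAdjoint.expUnitary ⟨_, (J i).isSelfAdjoint_compression h.2⟩,
      fun i => ?_, ?_⟩
    · exact norm_expUnitary_sub_one_le_of_norm_le ((J i).norm_compression_le _) hh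
    · simp only [selfAdjoint.expUnitary_coe]
      refine StrongTendsto.exp hJ (norm_nonneg (h : H →L[ℂ] H)) (fun i => ?_)
        ((strongTendsto_compression hJ _).smul _)
      rw [norm_smul, Complex.norm_I, one_mul]
      exact (J i).norm_compression_le _
  · obtain ⟨W, hW⟩ := exists_strongTendsto_unitary hJ w
    refine ⟨W, fun i => le_trans ?_ (not_lt.mp hw), hW⟩
    refine (norm_sub_le _ _).trans ?_
    have h1 := norm_le_one_of_mem_unitary (W i).2
    have h2 := norm_le_one_of_mem_unitary (one_mem (unitary (K i →L[ℂ] K i)))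
    linarith

include hJ in
/-- A sequence of unitaries is the strong limit of sequences of unitaries on finite-dimensional
spaces with no larger steps. -/
theorem exists_strongTendsto_unitary_seq [∀ i, FiniteDimensional ℂ (K i)]
    (g : ℕ → unitary (H →L[ℂ] H)) :
    ∃ G : ℕ → ∀ i, unitary (K i →L[ℂ] K i),
      (∀ k i, ‖(G (k + 1) i - G k i : K i →L[ℂ] K i)‖ ≤ ‖(g (k + 1) - g k : H →L[ℂ] H)‖) ∧
      ∀ k, StrongTendsto l J (fun i => (G k i : K i →L[ℂ] K i)) (g k) := by
  obtain ⟨W₀, hW₀⟩ := exists_strongTendsto_unitary hJ (g 0)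
  -- Multiplication by a unitary preserves norms, so the step at `k` has the norm of the increment
  -- minus `1`.
  choose W hW hWt using fun k =>
    exists_strongTendsto_unitary_norm_sub_one_le hJ ((g k)⁻¹ * g (k + 1))
  obtain ⟨G, hG₀, hG⟩ : ∃ G : ℕ → ∀ i, unitary (K i →L[ℂ] K i),
      G 0 = W₀ ∧ ∀ k, G (k + 1) = G k * W k :=
    ⟨fun k => Nat.rec W₀ (fun k G => G * W k) k, rfl, fun _ => rfl⟩
  refine ⟨G, fun k i => ?_, fun k => ?_⟩
  · have h1 : (G (k + 1) i - G k i : K i →L[ℂ] K i) = (G k i : K i →L[ℂ] K i) * (W k i - 1) := by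
      rw [hG, mul_sub, mul_one, Pi.mul_apply, Submonoid.coe_mul]
    have h2 : (g (k + 1) - g k : H →L[ℂ] H) =
        (g k : H →L[ℂ] H) * (((g k)⁻¹ * g (k + 1) : unitary (H →L[ℂ] H)) - 1) := by
      rw [mul_sub, mul_one, ← Submonoid.coe_mul, mul_inv_cancel_left]
    rw [h1, h2, CStarRing.norm_coe_unitary_mul, CStarRing.norm_coe_unitary_mul]
    exact hW k i
  · induction k with
    | zero => rwa [hG₀]
    | succ k ih =>
      have hC : ∀ i, ‖(G k i : K i →L[ℂ] K i)‖ ≤ 1 := fun i =>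
        norm_le_one_of_mem_unitary (SetLike.coe_mem (G k i))
      have h1 := ih.mul hC (hWt k)
      rw [← Submonoid.coe_mul, mul_inv_cancel_left] at h1
      rw [hG]
      exact h1

end StrongApproximation

/-! ### Diagonal unitaries and permutation unitaries -/

section CyclicModel

/-- The Hilbert space direct sum of copies of `E` indexed by `κ`. -/
abbrev L2Sum (κ E : Type*) : Type _ := PiLp 2 (fun _ : κ => E)

variable {κ : Type*} [Fintype κ] {E : Type*} [NormedAddCommGroup E] [InnerProductSpace ℂ E]
  [CompleteSpace E]

/-- The diagonal unitary on `⨁ E` with diagonal entries `g`. -/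
noncomputable def diagonalUnitary (g : κ → unitary (E →L[ℂ] E)) :
    unitary (L2Sum κ E →L[ℂ] L2Sum κ E) :=
  Unitary.linearIsometryEquiv.symm
    (LinearIsometryEquiv.piLpCongrRight 2 fun j => Unitary.linearIsometryEquiv (g j))

/-- The unitary on `⨁ E` that permutes the summands by `σ`. -/
noncomputable def permUnitary (E : Type*) [NormedAddCommGroup E] [InnerProductSpace ℂ E]
    [CompleteSpace E] (σ : Equiv.Perm κ) :
    unitary (L2Sum κ E →L[ℂ] L2Sum κ E) :=
  Unitary.linearIsometryEquiv.symm (LinearIsometryEquiv.piLpCongrLeft 2 ℂ E σ)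

theorem diagonalUnitary_apply (g : κ → unitary (E →L[ℂ] E)) (x : L2Sum κ E)
    (j : κ) : (diagonalUnitary g : L2Sum κ E →L[ℂ] L2Sum κ E) x j = (g j : E →L[ℂ] E) (x j) := rfl

theorem permUnitary_apply (σ : Equiv.Perm κ) (x : L2Sum κ E) (j : κ) :
    (permUnitary E σ : L2Sum κ E →L[ℂ] L2Sum κ E) x j = x (σ.symm j) := rfl

theorem norm_commutator_diagonalUnitary_permUnitary_le {ε : ℝ} (hε : 0 ≤ ε) (σ : Equiv.Perm κ)
    (g : κ → unitary (E →L[ℂ] E))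
    (hg : ∀ j, ‖(g (σ j) - g j : E →L[ℂ] E)‖ ≤ ε) :
    ‖(diagonalUnitary g * permUnitary E σ - permUnitary E σ * diagonalUnitary g :
      L2Sum κ E →L[ℂ] L2Sum κ E)‖ ≤ ε := by
  refine ContinuousLinearMap.opNorm_le_bound _ hε fun x => ?_
  -- After reindexing by `σ`, the coordinate `σ j` of the commutator applied to `x` is `(g (σ j) - g
  -- j) (x j)`, so the bound holds coordinatewise.
  rw [← sq_le_sq₀ (norm_nonneg _) (by positivity), mul_pow, PiLp.norm_sq_eq_of_L2,
    PiLp.norm_sq_eq_of_L2, ← Equiv.sum_comp σ, Finset.mul_sum]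
  refine Finset.sum_le_sum fun j _ => ?_
  rw [← mul_pow]
  gcongr
  have h1 : (diagonalUnitary g * permUnitary E σ - permUnitary E σ * diagonalUnitary g :
      L2Sum κ E →L[ℂ] L2Sum κ E) x (σ j) =
      (g (σ j) - g j : E →L[ℂ] E) (x j) := by
    change (g (σ j) : E →L[ℂ] E) (x (σ.symm (σ j))) - (g (σ.symm (σ j)) : E →L[ℂ] E)
      (x (σ.symm (σ j))) = _
    rw [σ.symm_apply_apply]
    rfl
  rw [h1]
  exact ContinuousLinearMap.le_of_opNorm_le _ (hg j) _

/-- The distance from `j` to `0` on a cycle of length `2 * m + 2`. -/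
def cycleDist (m : ℕ) (j : Fin (2 * m + 2)) : ℕ := min j (2 * m + 2 - j)

theorem cycleDist_of_le {m : ℕ} {j : Fin (2 * m + 2)} (hj : (j : ℕ) ≤ m) : cycleDist m j = j := by
  rw [cycleDist]
  omega

/-- Around the cycle the values are `0, 1, ..., m + 1, m, ..., 1`: neighbours differ by exactly one,
also across the seam. Composing a sequence with `cycleDist` thus closes it up without new steps. -/
theorem cycleDist_finRotate (m : ℕ) (j : Fin (2 * m + 2)) :
    cycleDist m (finRotate _ j) = cycleDist m j + 1 ∨
      cycleDist m j = cycleDist m (finRotate _ j) + 1 := by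
  rw [finRotate_apply, cycleDist, cycleDist, Fin.val_add_one]
  split_ifs with h
  · rw [h, Fin.val_last]
    omega
  · have h1 : (j : ℕ) ≠ 2 * m + 1 := fun h2 => h (Fin.ext h2)
    omega

theorem norm_cycleDist_finRotate_sub_le {ε : ℝ} (G : ℕ → unitary (E →L[ℂ] E))
    (hG : ∀ k, ‖(G (k + 1) - G k : E →L[ℂ] E)‖ ≤ ε) (m : ℕ) (j : Fin (2 * m + 2)) :
    ‖(G (cycleDist m (finRotate _ j)) - G (cycleDist m j) : E →L[ℂ] E)‖ ≤ ε := by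
  rcases cycleDist_finRotate m j with h | h
  · rw [h]
    exact hG _
  · rw [h, norm_sub_rev]
    exact hG _

/-! ### Spreading vectors along an orbit -/

section Spread

variable {H : Type*} [NormedAddCommGroup H] [InnerProductSpace ℂ H] [CompleteSpace H]
  (P : H →L[ℂ] E) (V : unitary (H →L[ℂ] H)) (m : ℕ)

/-- The map that sends `ξ` to the vector with the components
`(m + 1) ^ (-1 / 2) • P (V ^ (-j) ξ)`, for `0 ≤ j ≤ m`, along a cycle of length `2 * m + 2`. -/
noncomputable def orbitSpread : H →L[ℂ] L2Sum (Fin (2 * m + 2)) E :=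
  (PiLp.continuousLinearEquiv 2 ℂ fun _ : Fin (2 * m + 2) => E).symm.toContinuousLinearMap ∘L
    ContinuousLinearMap.pi fun j : Fin (2 * m + 2) =>
      if (j : ℕ) ≤ m then
        ((√(m + 1))⁻¹ : ℂ) • (P ∘L ((V⁻¹ ^ (j : ℕ) : unitary (H →L[ℂ] H)) : H →L[ℂ] H))
      else 0

omit [CompleteSpace E] in
theorem orbitSpread_apply (ξ : H) (j : Fin (2 * m + 2)) :
    orbitSpread P V m ξ j = if (j : ℕ) ≤ m then ((√(m + 1))⁻¹ : ℂ) •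
      P (((V⁻¹ ^ (j : ℕ) : unitary (H →L[ℂ] H)) : H →L[ℂ] H) ξ) else 0 := by
  change (if (j : ℕ) ≤ m then ((√(m + 1))⁻¹ : ℂ) •
    (P ∘L ((V⁻¹ ^ (j : ℕ) : unitary (H →L[ℂ] H)) : H →L[ℂ] H)) else 0) ξ = _
  split_ifs <;> rfl

omit [CompleteSpace E] in
theorem norm_sq_inv_sqrt_smul (x : E) :
    ‖((√(m + 1))⁻¹ : ℂ) • x‖ ^ 2 = (m + 1 : ℝ)⁻¹ * ‖x‖ ^ 2 := by
  rw [norm_smul, mul_pow, norm_inv, Complex.norm_real, inv_pow, Real.norm_eq_abs, sq_abs,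
    Real.sq_sqrt (by positivity)]

omit [CompleteSpace E] in
theorem norm_sq_of_forall_apply_eq (x : L2Sum (Fin (2 * m + 2)) E) (y : ℕ → E)
    (h : ∀ j, x j = if (j : ℕ) ≤ m then ((√(m + 1))⁻¹ : ℂ) • y j else 0) :
    ‖x‖ ^ 2 = (m + 1 : ℝ)⁻¹ * ∑ k ∈ Finset.range (m + 1), ‖y k‖ ^ 2 := by
  have h1 : ∀ j, ‖x j‖ ^ 2 = (fun k : ℕ => if k ≤ m then (m + 1 : ℝ)⁻¹ * ‖y k‖ ^ 2 else 0) j := by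
    intro j
    rw [h j]
    dsimp only
    split_ifs
    · exact norm_sq_inv_sqrt_smul m _
    · simp
  rw [PiLp.norm_sq_eq_of_L2, Finset.sum_congr rfl fun j _ => h1 j,
    Fin.sum_univ_eq_sum_range (fun k : ℕ => if k ≤ m then (m + 1 : ℝ)⁻¹ * ‖y k‖ ^ 2 else 0),
    Finset.mul_sum, ← Finset.sum_filter]
  congr 1
  ext k
  simp only [Finset.mem_filter, Finset.mem_range]
  omega

omit [CompleteSpace E] in
theorem norm_sq_orbitSpread (ξ : H) :
    ‖orbitSpread P V m ξ‖ ^ 2 = (m + 1 : ℝ)⁻¹ * ∑ k ∈ Finset.range (m + 1),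
      ‖P (((V⁻¹ ^ k : unitary (H →L[ℂ] H)) : H →L[ℂ] H) ξ)‖ ^ 2 :=
  norm_sq_of_forall_apply_eq m _ _ fun j => orbitSpread_apply P V m ξ j

theorem norm_unitary_apply (w : unitary (H →L[ℂ] H)) (ξ : H) : ‖(w : H →L[ℂ] H) ξ‖ = ‖ξ‖ :=
  (Unitary.linearIsometryEquiv w).norm_map ξ

omit [CompleteSpace E] in
theorem norm_orbitSpread_le (hP : ‖P‖ ≤ 1) : ‖orbitSpread P V m‖ ≤ 1 := by
  refine ContinuousLinearMap.opNorm_le_bound _ zero_le_one fun ξ => ?_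
  rw [one_mul, ← sq_le_sq₀ (norm_nonneg _) (norm_nonneg _), norm_sq_orbitSpread,
    inv_mul_le_iff₀ (by positivity)]
  refine (Finset.sum_le_card_nsmul _ _ (‖ξ‖ ^ 2) fun k _ => ?_).trans (by simp)
  have h1 := P.le_of_opNorm_le hP (((V⁻¹ ^ k : unitary (H →L[ℂ] H)) : H →L[ℂ] H) ξ)
  rw [one_mul, norm_unitary_apply] at h1
  gcongr

/-- Since `V⁻ᵏ U = (V⁻ᵏ U Vᵏ) V⁻ᵏ`, the error in block `k` only measures how well `G k` approximates
the `k`-th conjugate of `U`. The descending half of the cycle, where `cycleDist` is not the index,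
carries no component. -/
theorem norm_sq_diagonalUnitary_orbitSpread_sub (U : unitary (H →L[ℂ] H))
    (G : ℕ → unitary (E →L[ℂ] E)) (ξ : H) :
    ‖(diagonalUnitary (fun j => G (cycleDist m j)) :
        L2Sum (Fin (2 * m + 2)) E →L[ℂ] L2Sum (Fin (2 * m + 2)) E)
      (orbitSpread P V m ξ) -
      orbitSpread P V m ((U : H →L[ℂ] H) ξ)‖ ^ 2 =
    (m + 1 : ℝ)⁻¹ * ∑ k ∈ Finset.range (m + 1),
      ‖(G k : E →L[ℂ] E) (P (((V⁻¹ ^ k : unitary (H →L[ℂ] H)) : H →L[ℂ] H) ξ)) -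
        P (((V⁻¹ ^ k * U * V ^ k : unitary (H →L[ℂ] H)) : H →L[ℂ] H)
          (((V⁻¹ ^ k : unitary (H →L[ℂ] H)) : H →L[ℂ] H) ξ))‖ ^ 2 := by
  refine norm_sq_of_forall_apply_eq m _ _ fun j => ?_
  rw [PiLp.sub_apply, diagonalUnitary_apply, orbitSpread_apply, orbitSpread_apply]
  split_ifs with hj
  · rw [cycleDist_of_le hj, map_smul, ← smul_sub, ← mul_apply_eq_comp, ← mul_apply_eq_comp,
      ← Submonoid.coe_mul, ← Submonoid.coe_mul]
    simp [inv_pow]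
  · simp

/-- Shifting the blocks matches applying `V`, because `V⁻⁽ʲ⁺¹⁾ V = V⁻ʲ`. Only the two ends of the
support, `j = m` and the last index, fail to cancel. -/
theorem norm_sq_permUnitary_orbitSpread_sub_le (hP : ‖P‖ ≤ 1) (ξ : H) :
    ‖(permUnitary E (finRotate (2 * m + 2)) :
        L2Sum (Fin (2 * m + 2)) E →L[ℂ] L2Sum (Fin (2 * m + 2)) E)
      (orbitSpread P V m ξ) -
      orbitSpread P V m ((V : H →L[ℂ] H) ξ)‖ ^ 2 ≤ 2 * ‖ξ‖ ^ 2 * (m + 1 : ℝ)⁻¹ := by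
  have hPw : ∀ (w : unitary (H →L[ℂ] H)),
      ‖((√(m + 1))⁻¹ : ℂ) • P ((w : H →L[ℂ] H) ξ)‖ ^ 2 ≤ (m + 1 : ℝ)⁻¹ * ‖ξ‖ ^ 2 := fun w => by
    rw [norm_sq_inv_sqrt_smul]
    have h1 := P.le_of_opNorm_le hP ((w : H →L[ℂ] H) ξ)
    rw [one_mul, norm_unitary_apply] at h1
    gcongr
  have h0 : 0 ≤ (m + 1 : ℝ)⁻¹ * ‖ξ‖ ^ 2 := by positivity
  rw [PiLp.norm_sq_eq_of_L2, ← Equiv.sum_comp (finRotate (2 * m + 2))]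
  calc
    _ ≤ ∑ j : Fin (2 * m + 2), ((if j = ⟨m, by omega⟩ then (m + 1 : ℝ)⁻¹ * ‖ξ‖ ^ 2 else 0) +
        if j = Fin.last _ then (m + 1 : ℝ)⁻¹ * ‖ξ‖ ^ 2 else 0) := by
      refine Finset.sum_le_sum fun j _ => ?_
      rw [PiLp.sub_apply, permUnitary_apply, Equiv.symm_apply_apply, orbitSpread_apply,
        orbitSpread_apply, finRotate_apply, Fin.val_add_one]
      by_cases hl : j = Fin.last _
      -- The last index rotates to `0`, where the shifted vector vanishes but the spread of `V ξ`
      -- does not; at `j = m` the roles are reversed.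
      · have hjm : ¬ (j : ℕ) ≤ m := by rw [hl, Fin.val_last]; omega
        simp only [hl, if_true] at hjm ⊢
        rw [if_neg hjm, if_pos (Nat.zero_le m), zero_sub, norm_neg]
        refine le_add_of_nonneg_of_le (by split_ifs <;> simp [h0]) ?_
        rw [pow_zero, Submonoid.coe_one]
        exact hPw V
      · simp only [hl, if_false, add_zero]
        rcases lt_trichotomy (j : ℕ) m with h | h | h
        · rw [if_pos h.le, if_pos (Nat.succ_le_of_lt h), pow_succ V⁻¹, ← mul_apply_eq_comp,
            ← Submonoid.coe_mul, inv_mul_cancel_right, sub_self]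
          split_ifs <;> simp [h0]
        · have hj : j = ⟨m, by omega⟩ := Fin.ext h
          rw [if_pos h.le, if_neg (by omega), if_pos hj, sub_zero]
          exact hPw _
        · rw [if_neg (by omega), if_neg (by omega)]
          split_ifs <;> simp [h0]
    _ = _ := by
      rw [Finset.sum_add_distrib]
      simp
      ring

end Spread

end CyclicModel

/-! ### The soft torus is residually finite dimensional -/

/-! ### Iterated limits and the net of finite-dimensional subspaces. -/

theorem Filter.Tendsto.curry_of_forall {α β γ : Type*} {l : Filter α} {l' : Filter β}
    {k : Filter γ} {f : α × β → γ} (h : ∀ a, Tendsto (fun b => f (a, b)) l' k) :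
    Tendsto f (l.curry l') k := fun _ hs =>
  eventually_curry_iff.mpr (Eventually.of_forall fun a => h a hs)

theorem Filter.NeBot.curry {α β : Type*} {l : Filter α} {l' : Filter β} [l.NeBot] [l'.NeBot] :
    (l.curry l').NeBot := by
  refine ⟨fun h => ?_⟩
  have h1 : ∀ᶠ _ in l.curry l', False := by simp [h]
  rw [eventually_curry_iff] at h1
  simp [NeBot.ne] at h1

section FinSpan

variable {H : Type*} [NormedAddCommGroup H] [InnerProductSpace ℂ H]

/-- The finite-dimensional subspace spanned by a finite set of vectors. -/
abbrev finSpan (F : Finset H) : Submodule ℂ H := Submodule.span ℂ (F : Set H)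

theorem eventually_mem_range_finSpan (ξ : H) :
    ∀ᶠ F in atTop, ξ ∈ Set.range (finSpan F).subtypeₗᵢ := by
  classical
  filter_upwards [eventually_ge_atTop {ξ}] with F hF
  exact ⟨⟨ξ, Submodule.subset_span (hF (by simp))⟩, rfl⟩

end FinSpan

theorem tendsto_norm_of_tendsto_norm_sq {α : Type*} {l : Filter α} {f : α → ℝ} {a : ℝ}
    (hf : ∀ x, 0 ≤ f x) (ha : 0 ≤ a) (h : Tendsto (fun x => f x ^ 2) l (𝓝 (a ^ 2))) :
    Tendsto f l (𝓝 a) := by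
  have h1 := (Real.continuous_sqrt.tendsto _).comp h
  rw [Real.sqrt_sq ha] at h1
  exact h1.congr fun x => Real.sqrt_sq (hf x)

/-! ### Finite-dimensional models of a given representation. -/

namespace SoftTorus

variable {ε : ℝ} {H : Type*} [NormedAddCommGroup H] [InnerProductSpace ℂ H] [CompleteSpace H]

/-- The difference is `V⁻⁽ᵏ⁺¹⁾ (UV - VU) Vᵏ`. -/
theorem norm_conj_pow_succ_sub_le {D : Type*} [NormedRing D] [StarRing D] [CStarRing D]
    (U V : unitary D) (h : ‖(U * V - V * U : D)‖ ≤ ε) (k : ℕ) :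
    ‖((V⁻¹ ^ (k + 1) * U * V ^ (k + 1) : unitary D) - (V⁻¹ ^ k * U * V ^ k : unitary D) : D)‖
      ≤ ε := by
  have h1 : ((V⁻¹ ^ (k + 1) * U * V ^ (k + 1) : unitary D) -
      (V⁻¹ ^ k * U * V ^ k : unitary D) : D) =
      ((V⁻¹ ^ (k + 1) : unitary D) : D) * (U * V - V * U) * ((V ^ k : unitary D) : D) := by
    rw [mul_sub, sub_mul]
    simp only [← Submonoid.coe_mul]
    rw [show V⁻¹ ^ (k + 1) * (U * V) * V ^ k = V⁻¹ ^ (k + 1) * U * V ^ (k + 1) by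
        rw [pow_succ' V]; simp only [mul_assoc],
      show V⁻¹ ^ (k + 1) * (V * U) * V ^ k = V⁻¹ ^ k * U * V ^ k by
        rw [pow_succ V⁻¹]; simp only [mul_assoc, inv_mul_cancel_left]]
  rw [h1, CStarRing.norm_mul_coe_unitary, CStarRing.norm_coe_unitary_mul]
  exact h

theorem exists_starAlgHom_of_unitary (U V : unitary (H →L[ℂ] H))
    (h : ‖(U * V - V * U : H →L[ℂ] H)‖ ≤ ε) :
    ∃ π : SoftTorus ε →⋆ₐ[ℂ] (H →L[ℂ] H), π (u ε) = U ∧ π (v ε) = V :=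
  (existsUnique_starAlgHom U.2 V.2 h).exists

theorem exists_starAlgHom_cyclic {E : Type*} [NormedAddCommGroup E] [InnerProductSpace ℂ E]
    [CompleteSpace E] (hε : 0 ≤ ε) (G : ℕ → unitary (E →L[ℂ] E))
    (hG : ∀ k, ‖(G (k + 1) - G k : E →L[ℂ] E)‖ ≤ ε) (m : ℕ) :
    ∃ π : SoftTorus ε →⋆ₐ[ℂ] (L2Sum (Fin (2 * m + 2)) E →L[ℂ] L2Sum (Fin (2 * m + 2)) E),
      π (u ε) = diagonalUnitary (fun j => G (cycleDist m j)) ∧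
      π (v ε) = permUnitary E (finRotate (2 * m + 2)) :=
  exists_starAlgHom_of_unitary _ _ (norm_commutator_diagonalUnitary_permUnitary_le hε _ _
    (norm_cycleDist_finRotate_sub_le G hG m))

/-- Any representation of the soft torus is asymptotically contained in finite-dimensional
representations. -/
theorem exists_apply_ne_zero_of_apply_ne_zero {ι : Type*} {l' : Filter ι} [l'.NeBot]
    {K : ι → Type*} [∀ i, NormedAddCommGroup (K i)] [∀ i, InnerProductSpace ℂ (K i)]
    [∀ i, CompleteSpace (K i)] [∀ i, FiniteDimensional ℂ (K i)] {J : ∀ i, K i →ₗᵢ[ℂ] H}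
    (hJ : ∀ ξ, ∀ᶠ i in l', ξ ∈ Set.range (J i)) (hε : 0 ≤ ε)
    (ρ : SoftTorus ε →⋆ₐ[ℂ] (H →L[ℂ] H)) {a : SoftTorus ε} (ha : ρ a ≠ 0) :
    ∃ (m : ℕ) (i : ι) (π : SoftTorus ε →⋆ₐ[ℂ]
      (L2Sum (Fin (2 * m + 2)) (K i) →L[ℂ] L2Sum (Fin (2 * m + 2)) (K i))), π a ≠ 0 := by
  let U : unitary (H →L[ℂ] H) := ⟨ρ (u ε), Unitary.map_mem ρ (u_mem_unitary ε)⟩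
  let V : unitary (H →L[ℂ] H) := ⟨ρ (v ε), Unitary.map_mem ρ (v_mem_unitary ε)⟩
  have hUV : ‖(U * V - V * U : H →L[ℂ] H)‖ ≤ ε := by
    change ‖ρ (u ε) * ρ (v ε) - ρ (v ε) * ρ (u ε)‖ ≤ ε
    rw [← map_mul, ← map_mul, ← map_sub]
    exact (NonUnitalStarAlgHom.norm_apply_le ρ _).trans (norm_comm_le hε)
  obtain ⟨G, hG, hGt⟩ := exists_strongTendsto_unitary_seq hJ fun k => V⁻¹ ^ k * U * V ^ k
  let P : ∀ i, H →L[ℂ] K i := fun i => (J i).coisometry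
  have hP : ∀ F, ‖P F‖ ≤ 1 := fun F => LinearIsometry.norm_coisometry_le _
  have hπ : ∀ p : ℕ × ι, ∃ π : SoftTorus ε →⋆ₐ[ℂ]
      (L2Sum (Fin (2 * p.1 + 2)) (K p.2) →L[ℂ] L2Sum (Fin (2 * p.1 + 2)) (K p.2)),
      π (u ε) = diagonalUnitary (fun j => G (cycleDist p.1 j) p.2) ∧
      π (v ε) = permUnitary (K p.2) (finRotate (2 * p.1 + 2)) := fun p =>
    exists_starAlgHom_cyclic hε (fun k => G k p.2)
      (fun k => (hG k p.2).trans (norm_conj_pow_succ_sub_le U V hUV k)) p.1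
  choose π hπu hπv using hπ
  let W : ∀ p : ℕ × ι, H →L[ℂ] L2Sum (Fin (2 * p.1 + 2)) (K p.2) := fun p =>
    orbitSpread (P p.2) V p.1
  have hW : ∀ p, ‖W p‖ ≤ 1 := fun p => norm_orbitSpread_le _ _ _ (hP p.2)
  -- The order of limits matters: with `m` fixed only finitely many strong limits are involved, and
  -- these need not be uniform in `m`.
  let l : Filter (ℕ × ι) := (atTop : Filter ℕ).curry l'
  have hsum : ∀ (m : ℕ) {f : ℕ → ι → ℝ} {c : ℝ}, (∀ k, Tendsto (f k) l' (𝓝 c)) →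
      Tendsto (fun F => (m + 1 : ℝ)⁻¹ * ∑ k ∈ Finset.range (m + 1), f k F) l' (𝓝 c) := by
    intro m f c hf
    have h1 := (tendsto_finsetSum (Finset.range (m + 1)) fun k _ => hf k).const_mul (m + 1 : ℝ)⁻¹
    have h2 : (m + 1 : ℝ)⁻¹ * ∑ k ∈ Finset.range (m + 1), c = c := by
      rw [Finset.sum_const, Finset.card_range, nsmul_eq_mul]
      push_cast
      field_simp
    rwa [h2] at h1
  have hl : l.NeBot := .curry
  have hWt : ∀ ξ, Tendsto (fun p => ‖W p ξ‖) l (𝓝 ‖ξ‖) := fun ξ => by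
    refine Tendsto.curry_of_forall fun m => tendsto_norm_of_tendsto_norm_sq
      (fun _ => norm_nonneg _) (norm_nonneg _) ?_
    simp only [W, norm_sq_orbitSpread]
    refine hsum m fun k => ?_
    have h1 := (tendsto_norm_coisometry hJ (((V⁻¹ ^ k : unitary (H →L[ℂ] H)) : H →L[ℂ] H) ξ)).pow 2
    rwa [norm_unitary_apply] at h1
  have hu : u ε ∈ asymptoticIntertwiners l ρ π W := fun ξ => by
    refine Tendsto.curry_of_forall fun m => tendsto_norm_of_tendsto_norm_sq
      (fun _ => norm_nonneg _) le_rfl ?_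
    simp only [hπu]
    have h1 := fun F => norm_sq_diagonalUnitary_orbitSpread_sub (P F) V m U (fun k => G k F) ξ
    refine Tendsto.congr (fun F => (h1 F).symm) (hsum m fun k => ?_)
    exact ((hGt k).tendsto_norm_sub _).pow 2
  -- Unlike for `u`, the error vanishes only as `m → ∞`, at a rate independent of `i`.
  have hv : v ε ∈ asymptoticIntertwiners l ρ π W := fun ξ => by
    refine tendsto_norm_of_tendsto_norm_sq (fun _ => norm_nonneg _) le_rfl ?_
    simp only [hπv]
    have h1 : Tendsto (fun p : ℕ × ι => 2 * ‖ξ‖ ^ 2 * (p.1 + 1 : ℝ)⁻¹) l (𝓝 (0 ^ 2)) := by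
      have h2 := (tendsto_one_div_add_atTop_nhds_zero_nat (𝕜 := ℝ)).const_mul (2 * ‖ξ‖ ^ 2)
      have h3 : Tendsto Prod.fst l (atTop : Filter ℕ) := tendsto_fst.mono_left curry_le_prod
      have h4 := h2.comp h3
      simp only [mul_zero, one_div] at h4
      rw [zero_pow two_ne_zero]
      exact h4
    rw [zero_pow two_ne_zero] at h1 ⊢
    exact squeeze_zero (fun _ => sq_nonneg _)
      (fun p => norm_sq_permUnitary_orbitSpread_sub_le (P p.2) V p.1 (hP p.2) ξ) h1
  obtain ⟨ξ, hξ⟩ : ∃ ξ, ρ a ξ ≠ 0 := by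
    by_contra! h
    exact ha (ContinuousLinearMap.ext h)
  -- If every `π p a` is zero, the intertwining error at `ξ` is `‖W p (ρ a ξ)‖`, which tends both to
  -- `0` and to `‖ρ a ξ‖`.
  by_contra! h
  have h1 := mem_asymptoticIntertwiners hW hu hv a ξ
  have h2 : ∀ p, π p a = 0 := fun p => h p.1 p.2 (π p)
  simp only [h2, zero_apply, zero_sub, norm_neg] at h1
  exact hξ (norm_eq_zero.mp (tendsto_nhds_unique (hWt _) h1))

end SoftTorus

theorem mainTheorem1 (ε : ℝ) (hε : 0 < ε) :
    IsResiduallyFiniteDimensional (SoftTorus ε) := by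
  refine isResiduallyFiniteDimensional_of_forall_exists fun a ha => ?_
  obtain ⟨H, _, _, _, ρ, hρ⟩ := exists_starAlgHom_apply_ne_zero ha
  obtain ⟨m, F, π, hπ⟩ := SoftTorus.exists_apply_ne_zero_of_apply_ne_zero
    (K := fun F : Finset H => finSpan F) (J := fun F => (finSpan F).subtypeₗᵢ)
    eventually_mem_range_finSpan hε.le ρ hρ
  exact ⟨L2Sum (Fin (2 * m + 2)) (finSpan F), inferInstance, inferInstance, inferInstance,
    inferInstance, π, hπ⟩
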